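/- **Setting.** Let $\mathcal A=\langle A_\alpha:\alpha\le\omega_1\rangle$, where each $A_\alpha$ ($\alpha<\omega_1$) is a countable subset of $2^\omega$ that is dense (every $s\in 2^{<\omega}$ is an initial segment of some member of $A_\alpha$), $A_\alpha\subseteq A_\beta$ for $\alpha<\beta$, $A_{\omega_1}=\bigcup_{\alpha<\omega_1}A_\alpha$, and $\{\alpha<\omega_1: A_\alpha=\bigcup_{\beta<\alpha}A_\beta\}$ is stationary in $\omega_1$. Let $\mathcal D=(M,R_0,R_1,R_2,R_3,R_4)$ be a structure with $R_0,R_1,R_2$ binary and $R_3,R_4$ unary. For $a\in M$ let $\Omega(\mathcal D,a)$ be the set of $\eta\in 2^n$ ($n<\omega$) such that $R_4(a)$ and there are $y_0,\dots,y_n\in M$ with $R_3(y_0)$, $R_4(y_i)$ and $R_2(y_i,a)$ for $i\le n$, and $R_{\eta(i)}(y_i,y_{i+1})$ for $i<n$. Let $\Omega(\mathcal D)$ be the set of $\eta\in2^\omega$ for which there is $a\in M$ with $\eta\restriction n\in\Omega(\mathcal D,a)$ for all $n<\omega$. Call $\mathcal D$ *tree-like with unique representation* if 1. there is $x$ with $R_3(x)$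 such that $R_2(x,y)$ for every $y$ with $R_4(y)$; $R_0\cup R_1\subseteq R_2$; $R_2(x,y)$ implies $R_4(x)$ and $R_4(y)$; $R_4(x)$ implies $R_2(x,x)$; $R_2$ is transitive; and any two $R_2$-predecessors of the same element are $R_2$-comparable; 2. for every $a\in M$ and $n<\omega$ at most one $\eta\in 2^n$ belongs to $\Omega(\mathcal D,a)$. The formula $(Q_{\mathcal A}x_0x_1)(\psi_0,\psi_1,\psi_2,\psi_3,\psi_4)$, with $\psi_i(x_0,x_1,\bar z)$ for $i\le2$ and $\psi_i(x_0,\bar z)$ for $i=3,4$, holds in $\mathcal M$ at $\bar c$ if and only if the structure $\mathcal D$ on $M$ whose relations are defined in $\mathcal M$ by the $\psi_i(\cdot,\bar c)$ is tree-like with unique representation and $\Omega(\mathcal D)\cap A_{\omega_1}=A_\alpha$ for some $\alpha\le\omega_1$. $L^{d}_{\mathcal A}$ is the closure of first-order logic under $\wedge,\vee,\exists,\forall$, existential second-order quantification $\exists R$ over relations, and $Q_{\mathcal A}$; $L^{d,\omega}_{\mathcal A}$ allows in addition countable conjunctions. $L^{d^-}_{\mathcal A}$ and $L^{d^-,\omega}_{\mathcal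 A}$ consist of those formulas of $L^{d}_{\mathcal A}$ and $L^{d,\omega}_{\mathcal A}$, respectively, in which $Q_{\mathcal A}$ is applied to first-order formulas only (relation variables bound by a quantifier $\exists R$ may occur in them). A *fragment* is a set of formulas closed under subformulas. For a set $\Gamma$ of formulas, $\mathcal N\preccurlyeq^-_\Gamma\mathcal M$ means that $\mathcal N$ is a substructure of $\mathcal M$ and, for every $\varphi(x_1,\dots,x_n)\in\Gamma$ in the vocabulary of $\mathcal M$ and all $a_1,\dots,a_n\in N$, $\mathcal M\models\varphi(a_1,\dots,a_n)$ implies $\mathcal N\models\varphi(a_1,\dots,a_n)$. **Theorem.** Let $\mathcal M$ be a structure for a countable vocabulary and let $X\subseteq M$ be countable. Then there is $\mathcal N\preccurlyeq^-_{L^{d^-}_{\mathcal A}}\mathcal M$ with $X\subseteq N$ and $|N|\le\aleph_0$. Moreover, for every countable fragment $\Gamma$ of $L^{d^-,\omega}_{\mathcal A}$ there is $\mathcal N\preccurlyeq^-_{\Gamma}\mathcal M$ with $X\subseteq N$ and $|N|\le\aleph_0$. -/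

import Mathlib

open scoped Ordinal

universe u v w

namespace DensityLogic



/-! ### The vocabulary `{R₀, R₁, R₂, R₃, R₄}` and representation of reals -/

/-- A structure for the vocabulary `τ_d = {R₀, R₁, R₂, R₃, R₄}` on the universe `M`, with
`R₀, R₁, R₂` binary and `R₃, R₄` unary. -/
structure TauD (M : Type w) where
  R₀ : M → M → Prop
  R₁ : M → M → Prop
  R₂ : M → M → Prop
  R₃ : M → Prop
  R₄ : M → Prop

namespace TauD

variable {M : Type w} (D : TauD M)

/-- The relation `R_i` for `i = 0, 1`, the digits being coded as `false`, `true`. -/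
def edge : Bool → M → M → Prop
  | false => D.R₀
  | true => D.R₁

/-- `D.Psi s a` says that `D ⊨ ψ_s(a)`, that is, `s ∈ Ω(D, a)`, for a finite binary sequence `s` of
length `n`. -/
def Psi {n : ℕ} (s : Fin n → Bool) (a : M) : Prop :=
  D.R₄ a ∧ ∃ y : Fin (n + 1) → M,
    D.R₃ (y 0) ∧ (∀ i, D.R₄ (y i)) ∧
    (∀ i : Fin n, D.edge (s i) (y i.castSucc) (y i.succ)) ∧
    ∀ i, D.R₂ (y i) a

/-- `Ω(D)`, the set of reals represented by `D`: those `η ∈ 2^ω` for which some `a` satisfies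
`η ↾ n ∈ Ω(D, a)` for all `n`. -/
def Omega : Set (ℕ → Bool) :=
  {η | ∃ a : M, ∀ n : ℕ, D.Psi (fun i : Fin n => η i) a}

/-- The sentence `Θ_TL`: `R₂` is a tree-like order extending `R₀` and `R₁`. -/
def TreeLike : Prop :=
  (∃ x, D.R₃ x ∧ ∀ y, ¬ D.R₄ y ∨ D.R₂ x y) ∧
  (∀ x y, ¬ D.R₀ x y ∨ D.R₂ x y) ∧
  (∀ x y, ¬ D.R₁ x y ∨ D.R₂ x y) ∧
  (∀ x y, ¬ D.R₂ x y ∨ (D.R₄ x ∧ D.R₄ y)) ∧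
  (∀ x, ¬ D.R₄ x ∨ D.R₂ x x) ∧
  (∀ x y z, ¬ D.R₂ x y ∨ ¬ D.R₂ y z ∨ D.R₂ x z) ∧
  (∀ x y z, ¬ D.R₂ y x ∨ ¬ D.R₂ z x ∨ D.R₂ y z ∨ D.R₂ z y)

/-- Representation is unique: no element represents two different sequences of the same length
(equivalently, the finite sequences represented by an element are pairwise comparable). -/
def UniqueRep : Prop :=
  ∀ (a : M) (n : ℕ) (s t : Fin n → Bool), D.Psi s a → D.Psi t a → s = t

end TauD

/-! ### Chains of countable dense sets of reals -/

/-- `A ⊆ 2^ω` is dense: every finite binary sequence is an initial segment of a member of `A`. -/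
def IsDenseSet (A : Set (ℕ → Bool)) : Prop :=
  ∀ (n : ℕ) (s : Fin n → Bool), ∃ η ∈ A, ∀ i : Fin n, η i = s i

/-- The last member `A_{ω₁} = ⋃_{α < ω₁} A_α` of the sequence given by its members below `ω₁`. -/
def top (A : Set.Iio (ω₁ : Ordinal.{0}) → Set (ℕ → Bool)) : Set (ℕ → Bool) :=
  ⋃ α, A α

/-- `B ∈ 𝒜`, that is, `B = A_α` for some `α ≤ ω₁`. -/
def MemChain (A : Set.Iio (ω₁ : Ordinal.{0}) → Set (ℕ → Bool)) (B : Set (ℕ → Bool)) : Prop :=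
  (∃ α, B = A α) ∨ B = top A

/-- The requirements on `𝒜 = ⟨A_α : α ≤ ω₁⟩`: the `A_α` for `α < ω₁` are countable, dense and
increasing, and the set of `α < ω₁` with `A_α = ⋃_{β < α} A_β` is stationary in `ω₁`. -/
structure IsDenseChain (A : Set.Iio (ω₁ : Ordinal.{0}) → Set (ℕ → Bool)) : Prop where
  countable : ∀ α, (A α).Countable
  dense : ∀ α, IsDenseSet (A α)
  mono : ∀ α β, α < β → A α ⊆ A β
  stationary : IsStationary {α | A α = ⋃ β, ⋃ (_ : β < α), A β}

/-- The truth condition of the quantifier `Q_𝒜` for the `τ_d`-structure `D`: it is tree-like with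
unique representation, and `Ω(D) ∩ A_{ω₁} ∈ 𝒜`. -/
def QHolds {M : Type w} (A : Set.Iio (ω₁ : Ordinal.{0}) → Set (ℕ → Bool)) (D : TauD M) : Prop :=
  D.TreeLike ∧ D.UniqueRep ∧ MemChain A (D.Omega ∩ top A)

/-! ### Relation variables -/

/-- `RelVar σ k` is the type of the `k`-ary relation variables of a context `σ`, the list of the
arities of the relation variables in scope. -/
inductive RelVar : List ℕ → ℕ → Type
  | here {k : ℕ} {σ : List ℕ} : RelVar (k :: σ) k
  | there {j k : ℕ} {σ : List ℕ} : RelVar σ k → RelVar (j :: σ) k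

/-- The vocabulary `L` together with the relation variables of the context `σ` as additional
relation symbols. -/
abbrev withRels (L : FirstOrder.Language.{u, v}) (σ : List ℕ) : FirstOrder.Language.{u, v} :=
  L.sum (⟨fun _ => Empty, RelVar σ⟩ : FirstOrder.Language.{0, 0})

/-- An interpretation on `M` of the relation variables of the context `σ`. -/
def RelAssign (M : Type w) (σ : List ℕ) : Type w :=
  ∀ k : ℕ, RelVar σ k → Set (Fin k → M)

namespace RelAssign

variable {M : Type w}

/-- The interpretation of the empty list of relation variables. -/
def nil : RelAssign M [] := fun _ r => nomatch r

/-- Interpreting one more relation variable by `S`. -/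
def cons {k : ℕ} {σ : List ℕ} (S : Set (Fin k → M)) (ρ : RelAssign M σ) : RelAssign M (k :: σ)
  | _, .here => S
  | _, .there r => ρ _ r

/-- The expansion of an `L`-structure by an interpretation of relation variables. -/
@[reducible]
def expand (L : FirstOrder.Language.{u, v}) [L.Structure M] {σ : List ℕ} (ρ : RelAssign M σ) :
    (withRels L σ).Structure M :=
  letI : (⟨fun _ => Empty, RelVar σ⟩ : FirstOrder.Language.{0, 0}).Structure M :=
    { funMap := fun f => nomatch f
      RelMap := fun r x => x ∈ ρ _ r }
  inferInstance

end RelAssign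

/-! ### Formulas -/

/-- The formulas of `L^{d,ω}_𝒜` in the vocabulary `L`, with free relation variables as listed in `σ`
and free individual variables `x_0, …, x_{n-1}`: the closure of first-order logic under `∧`, `∨`,
`∃`, `∀`, `∃R`, the quantifier `Q_𝒜` and countable conjunctions. A first-order or second-order
quantifier binds the individual variable `x_n`, respectively the head of the context;
`Q_𝒜` binds `x_n, x_{n+1}` in the first three formulas and `x_n` in the last two. -/
inductive PosFormula (L : FirstOrder.Language.{u, v}) : List ℕ → ℕ → Type (max u v)
  | fo {σ : List ℕ} {n : ℕ} (φ : (withRels L σ).Formula (Fin n)) : PosFormula L σ n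
  | and {σ : List ℕ} {n : ℕ} (φ ψ : PosFormula L σ n) : PosFormula L σ n
  | or {σ : List ℕ} {n : ℕ} (φ ψ : PosFormula L σ n) : PosFormula L σ n
  | all {σ : List ℕ} {n : ℕ} (φ : PosFormula L σ (n + 1)) : PosFormula L σ n
  | ex {σ : List ℕ} {n : ℕ} (φ : PosFormula L σ (n + 1)) : PosFormula L σ n
  | exRel {σ : List ℕ} {n : ℕ} (k : ℕ) (φ : PosFormula L (k :: σ) n) : PosFormula L σ n
  | quant {σ : List ℕ} {n : ℕ} (ψ₀ ψ₁ ψ₂ : PosFormula L σ (n + 2))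
      (ψ₃ ψ₄ : PosFormula L σ (n + 1)) : PosFormula L σ n
  | conj {σ : List ℕ} {n : ℕ} (φ : ℕ → PosFormula L σ n) : PosFormula L σ n

namespace PosFormula

variable {L : FirstOrder.Language.{u, v}}

/-- Satisfaction of a formula in an `L`-structure `M`, under an interpretation `ρ` of the relation
variables and an assignment `c` of the individual variables. -/
def Realize (A : Set.Iio (ω₁ : Ordinal.{0}) → Set (ℕ → Bool)) {M : Type w} [L.Structure M] :
    ∀ {σ : List ℕ} {n : ℕ}, PosFormula L σ n → RelAssign M σ → (Fin n → M) → Prop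
  | _, _, fo φ, ρ, c => letI := ρ.expand L; φ.Realize c
  | _, _, and φ ψ, ρ, c => φ.Realize A ρ c ∧ ψ.Realize A ρ c
  | _, _, or φ ψ, ρ, c => φ.Realize A ρ c ∨ ψ.Realize A ρ c
  | _, _, all φ, ρ, c => ∀ x : M, φ.Realize A ρ (Fin.snoc c x)
  | _, _, ex φ, ρ, c => ∃ x : M, φ.Realize A ρ (Fin.snoc c x)
  | _, _, exRel k φ, ρ, c => ∃ S : Set (Fin k → M), φ.Realize A (ρ.cons S) c
  | _, n, quant ψ₀ ψ₁ ψ₂ ψ₃ ψ₄, ρ, c =>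
      QHolds A
        { R₀ := fun a b => ψ₀.Realize A ρ (Fin.snoc (Fin.snoc c a : Fin (n + 1) → M) b)
          R₁ := fun a b => ψ₁.Realize A ρ (Fin.snoc (Fin.snoc c a : Fin (n + 1) → M) b)
          R₂ := fun a b => ψ₂.Realize A ρ (Fin.snoc (Fin.snoc c a : Fin (n + 1) → M) b)
          R₃ := fun a => ψ₃.Realize A ρ (Fin.snoc c a)
          R₄ := fun a => ψ₄.Realize A ρ (Fin.snoc c a) }
  | _, _, conj φ, ρ, c => ∀ i : ℕ, (φ i).Realize A ρ c

/-- The formula is a first-order formula (possibly with relation variables as relation symbols). -/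
def IsFirstOrder : ∀ {σ : List ℕ} {n : ℕ}, PosFormula L σ n → Prop
  | _, _, fo _ => True
  | _, _, and φ ψ => φ.IsFirstOrder ∧ ψ.IsFirstOrder
  | _, _, or φ ψ => φ.IsFirstOrder ∧ ψ.IsFirstOrder
  | _, _, all φ => φ.IsFirstOrder
  | _, _, ex φ => φ.IsFirstOrder
  | _, _, exRel _ _ => False
  | _, _, quant _ _ _ _ _ => False
  | _, _, conj _ => False

/-- `Q_𝒜` is applied to first-order formulas only. -/
def IsMinus : ∀ {σ : List ℕ} {n : ℕ}, PosFormula L σ n → Prop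
  | _, _, fo _ => True
  | _, _, and φ ψ => φ.IsMinus ∧ ψ.IsMinus
  | _, _, or φ ψ => φ.IsMinus ∧ ψ.IsMinus
  | _, _, all φ => φ.IsMinus
  | _, _, ex φ => φ.IsMinus
  | _, _, exRel _ φ => φ.IsMinus
  | _, _, quant ψ₀ ψ₁ ψ₂ ψ₃ ψ₄ =>
      ψ₀.IsFirstOrder ∧ ψ₁.IsFirstOrder ∧ ψ₂.IsFirstOrder ∧ ψ₃.IsFirstOrder ∧ ψ₄.IsFirstOrder
  | _, _, conj φ => ∀ i : ℕ, (φ i).IsMinus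

/-- No infinite conjunction occurs in the formula, that is, it belongs to `L^d_𝒜`. -/
def IsFinitary : ∀ {σ : List ℕ} {n : ℕ}, PosFormula L σ n → Prop
  | _, _, fo _ => True
  | _, _, and φ ψ => φ.IsFinitary ∧ ψ.IsFinitary
  | _, _, or φ ψ => φ.IsFinitary ∧ ψ.IsFinitary
  | _, _, all φ => φ.IsFinitary
  | _, _, ex φ => φ.IsFinitary
  | _, _, exRel _ φ => φ.IsFinitary
  | _, _, quant ψ₀ ψ₁ ψ₂ ψ₃ ψ₄ =>
      ψ₀.IsFinitary ∧ ψ₁.IsFinitary ∧ ψ₂.IsFinitary ∧ ψ₃.IsFinitary ∧ ψ₄.IsFinitary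
  | _, _, conj _ => False

end PosFormula

/-! ### Fragments and the relation `≼⁻` -/

/-- A set of formulas, in all contexts. -/
abbrev FormulaSet (L : FirstOrder.Language.{u, v}) : Type (max u v) :=
  ∀ (σ : List ℕ) (n : ℕ), Set (PosFormula L σ n)

/-- The set of formulas of `L^{d⁻}_𝒜`. -/
def LdMinus (L : FirstOrder.Language.{u, v}) : FormulaSet L :=
  fun _ _ => {φ | φ.IsMinus ∧ φ.IsFinitary}

/-- The set of formulas of `L^{d⁻,ω}_𝒜`. -/
def LdMinusOmega (L : FirstOrder.Language.{u, v}) : FormulaSet L :=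
  fun _ _ => {φ | φ.IsMinus}

/-- A fragment: a set of formulas closed under subformulas. -/
structure IsFragment {L : FirstOrder.Language.{u, v}} (Γ : FormulaSet L) : Prop where
  and : ∀ {σ : List ℕ} {n : ℕ} {φ ψ : PosFormula L σ n},
    φ.and ψ ∈ Γ σ n → φ ∈ Γ σ n ∧ ψ ∈ Γ σ n
  or : ∀ {σ : List ℕ} {n : ℕ} {φ ψ : PosFormula L σ n},
    φ.or ψ ∈ Γ σ n → φ ∈ Γ σ n ∧ ψ ∈ Γ σ n
  all : ∀ {σ : List ℕ} {n : ℕ} {φ : PosFormula L σ (n + 1)},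
    φ.all ∈ Γ σ n → φ ∈ Γ σ (n + 1)
  ex : ∀ {σ : List ℕ} {n : ℕ} {φ : PosFormula L σ (n + 1)},
    φ.ex ∈ Γ σ n → φ ∈ Γ σ (n + 1)
  exRel : ∀ {σ : List ℕ} {n k : ℕ} {φ : PosFormula L (k :: σ) n},
    φ.exRel ∈ Γ σ n → φ ∈ Γ (k :: σ) n
  quant : ∀ {σ : List ℕ} {n : ℕ} {ψ₀ ψ₁ ψ₂ : PosFormula L σ (n + 2)}
    {ψ₃ ψ₄ : PosFormula L σ (n + 1)}, .quant ψ₀ ψ₁ ψ₂ ψ₃ ψ₄ ∈ Γ σ n →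
      ψ₀ ∈ Γ σ (n + 2) ∧ ψ₁ ∈ Γ σ (n + 2) ∧ ψ₂ ∈ Γ σ (n + 2) ∧
        ψ₃ ∈ Γ σ (n + 1) ∧ ψ₄ ∈ Γ σ (n + 1)
  conj : ∀ {σ : List ℕ} {n : ℕ} {φ : ℕ → PosFormula L σ n},
    .conj φ ∈ Γ σ n → ∀ i, φ i ∈ Γ σ n

/-- `N ≼⁻_Γ M`: every `L`-formula `φ(x_0, …, x_{n-1})` of `Γ` that is true in `M` of elements of the
substructure `N` is true of them in `N`. -/
def NegElementary {L : FirstOrder.Language.{u, v}} (A : Set.Iio (ω₁ : Ordinal.{0}) → Set (ℕ → Bool))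
    (Γ : FormulaSet L) {M : Type w} [L.Structure M] (N : L.Substructure M) : Prop :=
  ∀ (n : ℕ) (φ : PosFormula L [] n), φ ∈ Γ [] n → ∀ a : Fin n → N,
    φ.Realize A RelAssign.nil (fun i => (a i : M)) → φ.Realize A RelAssign.nil a

end DensityLogic

namespace DensityLogic

open Filter Set

/-! ### The club filter on the subsets of a set -/

/-! Almost all subsets `N` of `M ⊕ ω₁`, in the sense of the club filter, reflect what is true in
`M`. This filter is closed under countable intersections and under diagonal intersections, so
countably many requirements for each element of `N` can be imposed at once. It suffices to treat one
formula, one interpretation of the relation variables and one tuple at a time.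

The Boolean connectives, countable conjunctions and first-order quantifiers are routine. A witness
for `∃R` is restricted to the substructure. Since truth only has to pass downwards, nothing is
needed for false formulas, except inside `Q_𝒜`: there the formulas are first-order and are preserved
in both directions, so the structure they define on the substructure is the restriction of the
structure `D` they define on `M`.

The heart is `QHolds.eventually_comap`. If `Ω(D) ∩ A_{ω₁}` is a countable `A_α`, putting a
representing element for each of its reals into `N` keeps the set unchanged. If it is all of
`A_{ω₁}`, the summand `ω₁` is used: for each index `β` in `N`, elements representing the reals of
`A_β` are put into `N`; conversely an element of `N` represents at most one real, and if this lies
in `A_{ω₁}`, an index `β` of some `A_β` containing it is put into `N`. The set for the substructure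
is then the union of the `A_β` with `β` in `N`. When these `β` are exactly those below some `δ` at
which the chain is continuous, the union is `A_δ`. Such traces need not occur for almost all `N`,
but stationarity yields a countable `N` of this kind in every member of the club filter. -/

/-- `N` is closed under the set-valued function `f` of finite sets. -/
def ClosedUnder {T : Type w} (f : Finset T → Set T) (N : Set T) : Prop :=
  ∀ s : Finset T, ↑s ⊆ N → f s ⊆ N

/-- The filter generated by the families of all sets closed under a given function from finite
sets to countable sets. -/
def clubFilter (T : Type w) : Filter (Set T) :=
  Filter.ofCountableInter
    {P | ∃ f : Finset T → Set T, (∀ s, (f s).Countable) ∧ ∀ N, ClosedUnder f N → N ∈ P}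
    (by
      intro S hS h
      choose f hf hP using fun P : S => h P.2
      have := hS.to_subtype
      refine ⟨fun s => ⋃ P, f P s, fun s => countable_iUnion fun P => hf P s, ?_⟩
      exact fun N hN P hPS => hP ⟨P, hPS⟩ N fun s hs =>
        (subset_iUnion (fun P => f P s) _).trans (hN s hs))
    (by
      rintro P Q ⟨f, hf, hP⟩ hPQ
      exact ⟨f, hf, fun N hN => hPQ (hP N hN)⟩)

instance (T : Type w) : CountableInterFilter (clubFilter T) := by
  unfold clubFilter
  infer_instance

theorem eventually_clubFilter {T : Type w} {P : Set T → Prop} :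
    (∀ᶠ N in clubFilter T, P N) ↔
      ∃ f : Finset T → Set T, (∀ s, (f s).Countable) ∧ ∀ N, ClosedUnder f N → P N :=
  Iff.rfl

theorem eventually_mem_clubFilter {T : Type w} (x : T) : ∀ᶠ N in clubFilter T, x ∈ N :=
  eventually_clubFilter.2 ⟨fun _ => {x}, fun _ => countable_singleton x,
    fun _ hN => hN ∅ (by simp) rfl⟩

/-- The club filter is closed under diagonal intersections. -/
theorem eventually_forall_mem_clubFilter {T : Type w} {P : T → Set T → Prop}
    (h : ∀ x, ∀ᶠ N in clubFilter T, P x N) : ∀ᶠ N in clubFilter T, ∀ x ∈ N, P x N := by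
  classical
  choose f hf hP using fun x => eventually_clubFilter.1 (h x)
  -- Closure under this function implies closure under `f x` for each `x` in `N`: a finite `s ⊆ N`
  -- is handled by applying the joint function to `insert x s`, where `x` serves as index and `s` as
  -- subset.
  refine eventually_clubFilter.2
    ⟨fun s => ⋃ x ∈ s, ⋃ t ∈ s.powerset, f x t, fun s => ?_, fun N hN x hx => hP x N ?_⟩
  · exact s.countable_toSet.biUnion fun x _ => s.powerset.countable_toSet.biUnion fun t _ => hf x t
  · intro s hs y hy
    refine hN (insert x s) (by simp [insert_subset_iff, hx, hs]) ?_
    simp only [mem_iUnion]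
    exact ⟨x, by simp, s, by simp, hy⟩

theorem eventually_forall_inl {M : Type w} {I : Type v} {P : M → Set (M ⊕ I) → Prop}
    (h : ∀ x, ∀ᶠ N in clubFilter (M ⊕ I), P x N) :
    ∀ᶠ N in clubFilter (M ⊕ I), ∀ x, Sum.inl x ∈ N → P x N := by
  have := eventually_forall_mem_clubFilter (P := fun t N => ∀ x : M, t = Sum.inl x → P x N) ?_
  · filter_upwards [this] with N hN x hx using hN _ hx x rfl
  · rintro (x | x)
    · filter_upwards [h x] with N hN y hy
      cases hy
      exact hN
    · simp

theorem eventually_forall_inr {M : Type w} {I : Type v} {P : I → Set (M ⊕ I) → Prop}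
    (h : ∀ x, ∀ᶠ N in clubFilter (M ⊕ I), P x N) :
    ∀ᶠ N in clubFilter (M ⊕ I), ∀ x, Sum.inr x ∈ N → P x N := by
  have := eventually_forall_mem_clubFilter (P := fun t N => ∀ x : I, t = Sum.inr x → P x N) ?_
  · filter_upwards [this] with N hN x hx using hN _ hx x rfl
  · rintro (x | x)
    · simp
    · filter_upwards [h x] with N hN y hy
      cases hy
      exact hN

/-- Iterated diagonal intersection, one for each coordinate. -/
theorem eventually_forall_tuple {M : Type w} {I : Type v} {n : ℕ}
    {P : (Fin n → M) → Set (M ⊕ I) → Prop}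
    (h : ∀ c, ∀ᶠ N in clubFilter (M ⊕ I), P c N) :
    ∀ᶠ N in clubFilter (M ⊕ I), ∀ c : Fin n → M, (∀ i, Sum.inl (c i) ∈ N) → P c N := by
  induction n with
  | zero =>
    filter_upwards [h finZeroElim] with N hN c _
    rwa [Subsingleton.elim c finZeroElim]
  | succ n ih =>
    have := eventually_forall_inl fun x => ih (P := fun c N => P (Fin.cons x c) N) fun c => h _
    filter_upwards [this] with N hN c hc
    have := hN (c 0) (hc 0) (Fin.tail c) fun i => hc i.succ
    rwa [Fin.cons_self_tail] at this

/-! ### Closures -/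

section Closure

variable {T : Type w} (f : Finset T → Set T)

/-- The least set containing `Y` and closed under `f`. -/
def hull (Y : Set T) : Set T := ⋂₀ {N | Y ⊆ N ∧ ClosedUnder f N}

theorem subset_hull (Y : Set T) : Y ⊆ hull f Y := subset_sInter fun _ hN => hN.1

variable {f}

theorem hull_subset {Y N : Set T} (h : Y ⊆ N) (hN : ClosedUnder f N) : hull f Y ⊆ N :=
  sInter_subset_of_mem ⟨h, hN⟩

theorem closedUnder_hull (Y : Set T) : ClosedUnder f (hull f Y) :=
  fun s hs => subset_sInter fun _ hN => hN.2 s (hs.trans (sInter_subset_of_mem hN))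

theorem hull_mono {Y Z : Set T} (h : Y ⊆ Z) : hull f Y ⊆ hull f Z :=
  hull_subset (h.trans (subset_hull f Z)) (closedUnder_hull Z)

/-- Closure concerns finite sets only, and a finite subset of a directed union lies in one member.
-/
theorem ClosedUnder.biUnion {ι : Type v} {d : Set ι} (hd : d.Nonempty) {K : ι → Set T}
    (hK : DirectedOn (fun i j => K i ⊆ K j) d) (h : ∀ i ∈ d, ClosedUnder f (K i)) :
    ClosedUnder f (⋃ i ∈ d, K i) := by
  intro s hs
  obtain ⟨i, hi, hsi⟩ := DirectedOn.exists_mem_subset_of_finset_subset_biUnion hd hK hs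
  exact (h i hi s hsi).trans (subset_biUnion_of_mem hi)

/-- The hull is exhausted by `ω` rounds of adding `f s` for all finite `s` present so far; each
round adds countably many elements. -/
theorem countable_hull (hf : ∀ s, (f s).Countable) {Y : Set T} (hY : Y.Countable) :
    (hull f Y).Countable := by
  classical
  let step : Set T → Set T := fun Z => Z ∪ ⋃ s : Finset Z, f (s.map (Function.Embedding.subtype _))
  have hstep : ∀ Z : Set T, Z.Countable → (step Z).Countable := fun Z hZ => by
    have := hZ.to_subtype
    exact hZ.union (countable_iUnion fun s => hf _)
  let K : ℕ → Set T := fun n => step^[n] Y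
  have hKs : ∀ n, K (n + 1) = step (K n) := fun n => Function.iterate_succ_apply' step n Y
  have hKc : ∀ n, (K n).Countable := fun n => by
    induction n with
    | zero => exact hY
    | succ n ih => rw [hKs]; exact hstep _ ih
  have hKm : Monotone K := monotone_nat_of_le_succ fun n => by
    rw [hKs]; exact subset_union_left
  refine (countable_iUnion hKc).mono (hull_subset (subset_iUnion K 0) fun s hs => ?_)
  obtain ⟨n, hn⟩ := Directed.exists_mem_subset_of_finset_subset_biUnion hKm.directed_le hs
  refine Subset.trans ?_ (subset_iUnion K (n + 1))
  rw [hKs]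
  refine Subset.trans ?_ subset_union_right
  refine Subset.trans ?_ (subset_iUnion _ (s.subtype (· ∈ K n)))
  rw [Finset.subtype_map_of_mem fun x hx => hn hx]

end Closure

/-! ### Stationary sets in `ω₁` and the club filter -/

theorem countable_Iio_omega_one (β : Set.Iio (ω₁ : Ordinal.{0})) : (Set.Iio β).Countable := by
  have h : (Set.Iio β.1).Countable := by
    rw [← Cardinal.le_aleph0_iff_set_countable, Cardinal.mk_Iio_ordinal, Cardinal.lift_le_aleph0]
    have : ∀ o : Ordinal.{0}, o < ω₁ → o.card ≤ Cardinal.aleph0 := fun o ho => by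
      rw [← Cardinal.ord_aleph, Cardinal.lt_ord, ← Cardinal.succ_aleph0] at ho
      exact Order.lt_succ_iff.1 ho
    exact this _ β.2
  exact (h.preimage Subtype.val_injective).mono fun x hx => hx

theorem exists_forall_lt_omega_one {s : Set (Set.Iio (ω₁ : Ordinal.{0}))} (hs : s.Countable) :
    ∃ β, ∀ x ∈ s, x < β := by
  have := hs.to_subtype
  have h : ⨆ x : s, Order.succ x.1.1 < ω₁ := Ordinal.iSup_lt_omega_one fun x =>
    (Cardinal.isSuccLimit_omega 1).succ_lt x.1.2
  refine ⟨⟨_, h⟩, fun x hx => Subtype.coe_lt_coe.1 (Order.succ_le_iff.1 ?_)⟩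
  exact Ordinal.le_iSup (fun x : s => Order.succ x.1.1) ⟨x, hx⟩

/-- If `S` is stationary, every member of the club filter contains a countable set extending a given
one whose trace on `ω₁` is an ordinal in `S`. -/
theorem exists_countable_of_isStationary {M : Type w} {S : Set (Set.Iio (ω₁ : Ordinal.{0}))}
    (hS : IsStationary S) {P : Set (M ⊕ Set.Iio (ω₁ : Ordinal.{0})) → Prop}
    (hP : ∀ᶠ N in clubFilter _, P N) {X : Set M} (hX : X.Countable) :
    ∃ N, P N ∧ N.Countable ∧ (∀ x ∈ X, Sum.inl x ∈ N) ∧ ∃ δ ∈ S, ∀ β, Sum.inr β ∈ N ↔ β < δ := by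
  obtain ⟨f, hf, hP⟩ := eventually_clubFilter.1 hP
  let K : Set.Iio (ω₁ : Ordinal.{0}) → Set (M ⊕ Set.Iio (ω₁ : Ordinal.{0})) :=
    fun δ => hull f (Sum.inl '' X ∪ Sum.inr '' Set.Iio δ)
  have hKc : ∀ δ, (K δ).Countable := fun δ =>
    countable_hull hf ((hX.image _).union ((countable_Iio_omega_one δ).image _))
  have hKm : Monotone K := fun a b hab =>
    hull_mono (union_subset_union_right _ (image_mono (Iio_subset_Iio hab)))
  -- Continuity: at a supremum `δ`, every ordinal below `δ` lies below some member of `d`, so the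
  -- union of the earlier hulls already contains the generators of `K δ`.
  have hKsup : ∀ (d : Set (Set.Iio (ω₁ : Ordinal.{0}))) (δ), d.Nonempty → IsLUB d δ →
      K δ ⊆ ⋃ γ ∈ d, K γ := by
    intro d δ hd hδ
    refine hull_subset ?_ (ClosedUnder.biUnion hd ?_ fun γ _ => closedUnder_hull _)
    · rintro _ (hx | ⟨β, hβ, rfl⟩)
      · obtain ⟨γ, hγ⟩ := hd
        exact mem_biUnion hγ (subset_hull f _ (Or.inl hx))
      · obtain ⟨γ, hγ, hβγ⟩ := (lt_isLUB_iff hδ).1 hβ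
        exact mem_biUnion hγ (subset_hull f _ (Or.inr ⟨β, hβγ, rfl⟩))
    · intro a ha b hb
      rcases le_total a b with h | h
      · exact ⟨b, hb, hKm h, Subset.rfl⟩
      · exact ⟨a, ha, Subset.rfl, hKm h⟩
  -- These are the `δ` for which `K δ` has trace exactly `δ`, the other inclusion being built into
  -- the generators. Closedness is the continuity of `K`; for unboundedness, iterate `g`, which
  -- bounds the trace of `K δ`, and take the supremum after `ω` steps.
  have hclub : IsClub {δ | ∀ β, Sum.inr β ∈ K δ → β < δ} := by
    constructor
    · intro d hdC hd _ δ hδ β hβ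
      obtain ⟨γ, hγ, hβγ⟩ := mem_iUnion₂.1 (hKsup d δ hd hδ hβ)
      exact (hdC hγ β hβγ).trans_le (hδ.1 hγ)
    · intro a
      have hnext : ∀ δ, ∃ δ', ∀ β, Sum.inr β ∈ K δ → β < δ' := fun δ =>
        exists_forall_lt_omega_one ((hKc δ).preimage Sum.inr_injective)
      choose g hg using hnext
      let b : ℕ → Set.Iio (ω₁ : Ordinal.{0}) := fun n => g^[n] a
      have hbs : ∀ n, b (n + 1) = g (b n) := fun n => Function.iterate_succ_apply' g n a
      obtain ⟨u, hu⟩ := exists_forall_lt_omega_one (countable_range b)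
      obtain ⟨δ, hδ⟩ : ∃ δ, IsLUB (range b) δ := by
        have hne : (upperBounds (range b)).Nonempty := ⟨u, fun x hx => (hu x hx).le⟩
        exact ⟨wellFounded_lt.min _ hne, wellFounded_lt.min_mem _ hne,
          fun x hx => not_lt.1 (wellFounded_lt.not_lt_min _ hx)⟩
      refine ⟨δ, fun β hβ => ?_, hδ.1 ⟨0, rfl⟩⟩
      obtain ⟨_, ⟨n, rfl⟩, hn⟩ := mem_iUnion₂.1 (hKsup _ δ (range_nonempty b) hδ hβ)
      refine (hg _ β hn).trans_le ?_
      rw [← hbs]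
      exact hδ.1 ⟨n + 1, rfl⟩
  obtain ⟨δ, hδS, hδ⟩ := hS hclub
  exact ⟨K δ, hP _ (closedUnder_hull _), hKc δ,
    fun x hx => subset_hull f _ (Or.inl ⟨x, hx, rfl⟩), δ, hδS, fun β =>
    ⟨hδ β, fun h => subset_hull f _ (Or.inr ⟨β, h, rfl⟩)⟩⟩

open FirstOrder

/-! ### Preservation of the quantifier `Q_𝒜` -/

/-- The trace of `N` on `ω₁` is an ordinal `δ` at which the chain `A` is continuous. -/
def IsContinuityTrace (A : Set.Iio (ω₁ : Ordinal.{0}) → Set (ℕ → Bool)) {M : Type w}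
    (N : Set (M ⊕ Set.Iio (ω₁ : Ordinal.{0}))) : Prop :=
  ∃ δ ∈ {α | A α = ⋃ β, ⋃ (_ : β < α), A β}, ∀ β, Sum.inr β ∈ N ↔ β < δ

namespace TauD

variable {M S : Type w} (D : TauD M)

/-- The structure induced on `S` by a map into the universe of `D`. -/
def comap (f : S → M) : TauD S where
  R₀ a b := D.R₀ (f a) (f b)
  R₁ a b := D.R₁ (f a) (f b)
  R₂ a b := D.R₂ (f a) (f b)
  R₃ a := D.R₃ (f a)
  R₄ a := D.R₄ (f a)

theorem edge_comap (f : S → M) (i : Bool) (a b : S) :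
    (D.comap f).edge i a b ↔ D.edge i (f a) (f b) := by
  cases i <;> rfl

theorem Psi.of_comap {D : TauD M} {f : S → M} {n : ℕ} {s : Fin n → Bool} {a : S}
    (h : (D.comap f).Psi s a) : D.Psi s (f a) := by
  obtain ⟨ha, y, h3, h4, he, h2⟩ := h
  exact ⟨ha, f ∘ y, h3, h4, fun i => (D.edge_comap f _ _ _).1 (he i), h2⟩

/-- For a fixed `a` there are only countably many finite binary sequences, so a witnessing path for
each of them that `a` represents can be put into `N`. -/
theorem eventually_psi_comap {I : Type v} :
    ∀ᶠ N in clubFilter (M ⊕ I), ∀ (S : Type w) (f : S → M), range f = Sum.inl ⁻¹' N →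
      ∀ (a : S) (n : ℕ) (s : Fin n → Bool), (D.comap f).Psi s a ↔ D.Psi s (f a) := by
  have key : ∀ᶠ N in clubFilter (M ⊕ I), ∀ a : M, Sum.inl a ∈ N → ∀ (n : ℕ) (s : Fin n → Bool),
      D.Psi s a → D.R₄ a ∧ ∃ y : Fin (n + 1) → M, (D.R₃ (y 0) ∧ (∀ i, D.R₄ (y i)) ∧
        (∀ i : Fin n, D.edge (s i) (y i.castSucc) (y i.succ)) ∧ ∀ i, D.R₂ (y i) a) ∧
        ∀ i, Sum.inl (y i) ∈ N := by
    refine eventually_forall_inl fun a => ?_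
    refine eventually_countable_forall.2 fun n => eventually_countable_forall.2 fun s => ?_
    by_cases h : D.Psi s a
    · obtain ⟨ha, y, hy⟩ := h
      filter_upwards [eventually_countable_forall.2 fun i => eventually_mem_clubFilter
        (Sum.inl (y i) : M ⊕ I)] with N hN _
      exact ⟨ha, y, hy, hN⟩
    · exact Eventually.of_forall fun N h' => (h h').elim
  filter_upwards [key] with N hN S f hf a n s
  refine ⟨Psi.of_comap, fun h => ?_⟩
  obtain ⟨ha, y, ⟨h3, h4, he, h2⟩, hy⟩ := hN (f a) (hf.subset ⟨a, rfl⟩) n s h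
  choose z hz using fun i => hf.superset (hy i)
  refine ⟨ha, z, ?_, fun i => ?_, fun i => (D.edge_comap f _ _ _).2 ?_, fun i => ?_⟩
  · simpa only [comap, hz] using h3
  · simpa only [comap, hz] using h4 i
  · simpa only [hz] using he i
  · simpa only [comap, hz] using h2 i

/-- All clauses are universal except the existence of a root, which is put into `N`. -/
theorem TreeLike.eventually_comap {I : Type v} {D : TauD M} (hD : D.TreeLike) :
    ∀ᶠ N in clubFilter (M ⊕ I), ∀ (S : Type w) (f : S → M), range f = Sum.inl ⁻¹' N →
      (D.comap f).TreeLike := by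
  obtain ⟨⟨x, h3, hx⟩, h0, h1, h24, hr, ht, hc⟩ := hD
  filter_upwards [eventually_mem_clubFilter (Sum.inl x : M ⊕ I)] with N hN S f hf
  obtain ⟨z, rfl⟩ := hf.superset hN
  exact ⟨⟨z, h3, fun y => hx _⟩, fun _ _ => h0 _ _, fun _ _ => h1 _ _, fun _ _ => h24 _ _,
    fun _ => hr _, fun _ _ _ => ht _ _ _, fun _ _ _ => hc _ _ _⟩

theorem UniqueRep.comap {D : TauD M} (hD : D.UniqueRep) (f : S → M) : (D.comap f).UniqueRep :=
  fun a n s t hs ht => hD (f a) n s t hs.of_comap ht.of_comap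

/-- Ensures that each element of `N` requires at most one index in `ω₁` to be added. -/
theorem UniqueRep.eq {D : TauD M} (hD : D.UniqueRep) {a : M} {η ζ : ℕ → Bool}
    (hη : ∀ n : ℕ, D.Psi (fun i : Fin n => η i) a) (hζ : ∀ n : ℕ, D.Psi (fun i : Fin n => ζ i) a) :
    η = ζ := by
  funext k
  exact congrFun (hD a (k + 1) _ _ (hη (k + 1)) (hζ (k + 1))) (Fin.last k)

theorem omega_comap_subset {D : TauD M} (f : S → M) : (D.comap f).Omega ⊆ D.Omega := by
  rintro η ⟨a, ha⟩
  exact ⟨f a, fun n => (ha n).of_comap⟩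

/-- A countable set of represented reals is represented in almost all substructures. -/
theorem eventually_subset_omega_comap {I : Type v} {D : TauD M} {B : Set (ℕ → Bool)}
    (hB : B.Countable) (hBD : B ⊆ D.Omega) :
    ∀ᶠ N in clubFilter (M ⊕ I), ∀ (S : Type w) (f : S → M), range f = Sum.inl ⁻¹' N →
      B ⊆ (D.comap f).Omega := by
  have h : ∀ᶠ N in clubFilter (M ⊕ I), ∀ η ∈ B, ∃ a, Sum.inl a ∈ N ∧
      ∀ n : ℕ, D.Psi (fun i : Fin n => η i) a := by
    refine (eventually_countable_ball hB).2 fun η hη => ?_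
    obtain ⟨a, ha⟩ := hBD hη
    filter_upwards [eventually_mem_clubFilter (Sum.inl a : M ⊕ I)] with N hN using ⟨a, hN, ha⟩
  filter_upwards [h, D.eventually_psi_comap] with N hN hPsi S f hf η hη
  obtain ⟨a, haN, ha⟩ := hN η hη
  obtain ⟨z, rfl⟩ := hf.superset haN
  exact ⟨z, fun n => (hPsi S f hf z n _).2 (ha n)⟩

end TauD

theorem subset_top (A : Set.Iio (ω₁ : Ordinal.{0}) → Set (ℕ → Bool)) (α) : A α ⊆ top A :=
  subset_iUnion A α

/-- `Q_𝒜` is inherited by almost all substructures with a suitable trace on `ω₁`. -/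
theorem QHolds.eventually_comap {M : Type w} {A : Set.Iio (ω₁ : Ordinal.{0}) → Set (ℕ → Bool)}
    (hA : IsDenseChain A) {D : TauD M} (hD : QHolds A D) :
    ∀ᶠ N in clubFilter (M ⊕ Set.Iio (ω₁ : Ordinal.{0})), IsContinuityTrace A N →
      ∀ (S : Type w) (f : S → M), range f = Sum.inl ⁻¹' N → QHolds A (D.comap f) := by
  obtain ⟨hT, hU, hC⟩ := hD
  suffices h : ∀ᶠ N in clubFilter (M ⊕ Set.Iio (ω₁ : Ordinal.{0})), IsContinuityTrace A N →
      ∀ (S : Type w) (f : S → M), range f = Sum.inl ⁻¹' N →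
        MemChain A ((D.comap f).Omega ∩ top A) by
    filter_upwards [h, hT.eventually_comap] with N hN hTN hδ S f hf
    exact ⟨hTN S f hf, hU.comap f, hN hδ S f hf⟩
  rcases hC with ⟨α, hα⟩ | htop
  -- Here the countable set `A α` itself survives, whatever the trace of `N` on `ω₁`.
  · filter_upwards [TauD.eventually_subset_omega_comap (hA.countable α)
      (hα.symm.subset.trans inter_subset_left)] with N hN _ S f hf
    refine Or.inl ⟨α, Subset.antisymm ?_ (subset_inter (hN S f hf) (subset_top A α))⟩
    rw [← hα]
    exact inter_subset_inter_left _ (TauD.omega_comap_subset f)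
  · have hlow := eventually_forall_inr (M := M) fun β : Set.Iio (ω₁ : Ordinal.{0}) =>
      TauD.eventually_subset_omega_comap (I := Set.Iio (ω₁ : Ordinal.{0})) (D := D)
        (hA.countable β) ((subset_top A β).trans (htop.symm.subset.trans inter_subset_left))
    -- Choose one index `β` for the only real of `A_{ω₁}` that `a` can represent.
    have hup : ∀ᶠ N in clubFilter (M ⊕ Set.Iio (ω₁ : Ordinal.{0})), ∀ a : M, Sum.inl a ∈ N →
        ∀ η ∈ top A, (∀ n : ℕ, D.Psi (fun i : Fin n => η i) a) → ∃ β, Sum.inr β ∈ N ∧ η ∈ A β := by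
      refine eventually_forall_inl fun a => ?_
      by_cases h : ∃ η ∈ top A, ∀ n : ℕ, D.Psi (fun i : Fin n => η i) a
      · obtain ⟨η, hη, hηa⟩ := h
        obtain ⟨β, hβ⟩ := mem_iUnion.1 hη
        filter_upwards [eventually_mem_clubFilter
          (Sum.inr β : M ⊕ Set.Iio (ω₁ : Ordinal.{0}))] with N hN ζ _ hζa
        exact ⟨β, hN, hU.eq hηa hζa ▸ hβ⟩
      · push Not at h
        refine Eventually.of_forall fun N η hη hηa => ?_
        obtain ⟨n, hn⟩ := h η hη
        exact (hn (hηa n)).elim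
    filter_upwards [hlow, hup] with N hN₁ hN₂ hδ S f hf
    obtain ⟨δ, hδA, hδ⟩ := hδ
    refine Or.inl ⟨δ, ?_⟩
    rw [hδA]
    apply Subset.antisymm
    · rintro η ⟨⟨a, ha⟩, hη⟩
      obtain ⟨β, hβN, hβ⟩ := hN₂ (f a) (hf.subset ⟨a, rfl⟩) η hη fun n => (ha n).of_comap
      exact mem_iUnion₂.2 ⟨β, (hδ β).1 hβN, hβ⟩
    · refine iUnion₂_subset fun β hβ => ?_
      exact subset_inter (hN₁ β ((hδ β).2 hβ) S f hf) (subset_top A β)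

/-! ### Relation variables and first-order formulas -/

namespace RelAssign

/-- The interpretation induced on `S` by a map into `M`. -/
def comap {M S : Type w} (f : S → M) {σ : List ℕ} (ρ : RelAssign M σ) : RelAssign S σ :=
  fun k r => {x | f ∘ x ∈ ρ k r}

theorem comap_nil {M S : Type w} (f : S → M) : (nil : RelAssign M []).comap f = nil := by
  funext k r
  nomatch r

theorem comap_cons {M S : Type w} (f : S → M) {σ : List ℕ} {k : ℕ} (R : Set (Fin k → M))
    (ρ : RelAssign M σ) : (ρ.cons R).comap f = (ρ.comap f).cons {x | f ∘ x ∈ R} := by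
  funext j r
  cases r <;> rfl

variable {L : FirstOrder.Language.{u, v}} {M : Type w} [L.Structure M] {σ : List ℕ}

theorem realize_term_comap (ρ : RelAssign M σ) (S : L.Substructure M) {α : Type*}
    (t : (withRels L σ).Term α) (v : α → S) :
    ((letI := (ρ.comap (Subtype.val : S → M)).expand L; t.realize v : S) : M) =
      (letI := ρ.expand L; t.realize fun i => (v i : M)) := by
  induction t with
  | var i => rfl
  | @func l F ts ih =>
    rcases F with F | F
    · exact congrArg (Language.Structure.funMap F) (funext ih)
    · exact F.elim

/-- Almost all substructures are elementary for a given first-order formula with parameters for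
relation variables. -/
theorem eventually_realize_boundedFormula {I : Type*} (ρ : RelAssign M σ) {n k : ℕ}
    (φ : (withRels L σ).BoundedFormula (Fin n) k) :
    ∀ᶠ N in clubFilter (M ⊕ I), ∀ S : L.Substructure M, (S : Set M) = Sum.inl ⁻¹' N →
      ∀ (c : Fin n → S) (x : Fin k → S),
        (letI := (ρ.comap (Subtype.val : S → M)).expand L; φ.Realize c x) ↔
          (letI := ρ.expand L; φ.Realize (fun i => (c i : M)) (fun i => (x i : M))) := by
  have helim : ∀ {m : ℕ} (S : L.Substructure M) (c : Fin n → S) (x : Fin m → S),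
      (fun i => ((Sum.elim c x i : S) : M)) =
        Sum.elim (fun i => (c i : M)) (fun i => (x i : M)) := fun S c x => by
    funext i
    cases i <;> rfl
  induction φ with
  | falsum => exact Eventually.of_forall fun N S _ c x => Iff.rfl
  | equal t₁ t₂ =>
    refine Eventually.of_forall fun N S _ c x => ?_
    simp only [Language.BoundedFormula.Realize]
    rw [← helim, ← realize_term_comap, ← realize_term_comap]
    exact Subtype.ext_iff
  | @rel _ l R ts =>
    refine Eventually.of_forall fun N S _ c x => ?_
    simp only [Language.BoundedFormula.Realize]
    rw [← helim]
    simp only [← realize_term_comap]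
    rcases R with R | R <;> exact Iff.rfl
  | imp φ ψ ihφ ihψ =>
    filter_upwards [ihφ, ihψ] with N h₁ h₂ S hS c x
    exact imp_congr (h₁ S hS c x) (h₂ S hS c x)
  | @all m φ ih =>
    let := ρ.expand L
    -- Tarski–Vaught: for each tuple from `N` at which the universal statement fails, a
    -- counterexample is put into `N`.
    have hw : ∀ᶠ N in clubFilter (M ⊕ I), ∀ c : Fin n → M, (∀ i, Sum.inl (c i) ∈ N) →
        ∀ x : Fin m → M, (∀ i, Sum.inl (x i) ∈ N) →
          (∀ y : M, Sum.inl y ∈ N → φ.Realize c (Fin.snoc x y)) →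
            ∀ y : M, φ.Realize c (Fin.snoc x y) := by
      refine eventually_forall_tuple fun c => eventually_forall_tuple fun x => ?_
      by_cases h : ∀ y : M, φ.Realize c (Fin.snoc x y)
      · exact Eventually.of_forall fun _ _ => h
      · push Not at h
        obtain ⟨y, hy⟩ := h
        filter_upwards [eventually_mem_clubFilter (Sum.inl y : M ⊕ I)] with N hN h'
        exact (hy (h' y hN)).elim
    filter_upwards [ih, hw] with N h₁ h₂ S hS c x
    have hsnoc : ∀ y : S, (fun i => ((Fin.snoc x y : Fin (m + 1) → S) i : M)) =
        Fin.snoc (fun i => (x i : M)) (y : M) := fun y =>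
      Fin.comp_snoc (Subtype.val : S → M) x y
    constructor
    · intro h
      refine h₂ _ (fun i => hS.subset (c i).2) _ (fun i => hS.subset (x i).2) fun y hy => ?_
      have := (h₁ S hS c _).1 (h ⟨y, hS.superset hy⟩)
      rwa [hsnoc] at this
    · intro h y
      refine (h₁ S hS c _).2 ?_
      rw [hsnoc]
      exact h y

end RelAssign

namespace PosFormula

variable {L : FirstOrder.Language.{u, v}} {M : Type w} [L.Structure M]
  {A : Set.Iio (ω₁ : Ordinal.{0}) → Set (ℕ → Bool)}

/-- First-order formulas may also be built with the outer connectives and quantifiers, so the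
Tarski–Vaught argument is repeated for these. No condition on the trace is needed. -/
theorem eventually_realize_iff {I : Type*} {σ : List ℕ} {n : ℕ} (φ : PosFormula L σ n)
    (hφ : φ.IsFirstOrder) (ρ : RelAssign M σ) :
    ∀ᶠ N in clubFilter (M ⊕ I), ∀ S : L.Substructure M, (S : Set M) = Sum.inl ⁻¹' N →
      ∀ c : Fin n → S,
        φ.Realize A (ρ.comap (Subtype.val : S → M)) c ↔ φ.Realize A ρ (Subtype.val ∘ c) := by
  induction φ with
  | fo φ =>
    filter_upwards [ρ.eventually_realize_boundedFormula (I := I) φ] with N hN S hS c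
    simp only [Realize, FirstOrder.Language.Formula.Realize]
    rw [hN S hS c default, Subsingleton.elim (fun i => ((default : Fin 0 → S) i : M)) default]
    rfl
  | and φ ψ ihφ ihψ =>
    filter_upwards [ihφ hφ.1 ρ, ihψ hφ.2 ρ] with N h₁ h₂ S hS c
    exact and_congr (h₁ S hS c) (h₂ S hS c)
  | or φ ψ ihφ ihψ =>
    filter_upwards [ihφ hφ.1 ρ, ihψ hφ.2 ρ] with N h₁ h₂ S hS c
    exact or_congr (h₁ S hS c) (h₂ S hS c)
  | @all σ m φ ih =>
    have hw : ∀ᶠ N in clubFilter (M ⊕ I), ∀ c : Fin m → M, (∀ i, Sum.inl (c i) ∈ N) →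
        (∀ y : M, Sum.inl y ∈ N → φ.Realize A ρ (Fin.snoc c y)) →
          ∀ y : M, φ.Realize A ρ (Fin.snoc c y) := by
      refine eventually_forall_tuple fun c => ?_
      by_cases h : ∀ y : M, φ.Realize A ρ (Fin.snoc c y)
      · exact Eventually.of_forall fun _ _ => h
      · push Not at h
        obtain ⟨y, hy⟩ := h
        filter_upwards [eventually_mem_clubFilter (Sum.inl y : M ⊕ I)] with N hN h'
        exact (hy (h' y hN)).elim
    filter_upwards [ih hφ ρ, hw] with N h₁ h₂ S hS c
    constructor
    · intro h
      refine h₂ _ (fun i => hS.subset (c i).2) fun y hy => ?_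
      have := (h₁ S hS _).1 (h ⟨y, hS.superset hy⟩)
      rwa [Fin.comp_snoc] at this
    · intro h y
      refine (h₁ S hS _).2 ?_
      rw [Fin.comp_snoc]
      exact h y
  | @ex σ m φ ih =>
    have hw : ∀ᶠ N in clubFilter (M ⊕ I), ∀ c : Fin m → M, (∀ i, Sum.inl (c i) ∈ N) →
        (∃ y : M, φ.Realize A ρ (Fin.snoc c y)) →
          ∃ y : M, Sum.inl y ∈ N ∧ φ.Realize A ρ (Fin.snoc c y) := by
      refine eventually_forall_tuple fun c => ?_
      by_cases h : ∃ y : M, φ.Realize A ρ (Fin.snoc c y)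
      · obtain ⟨y, hy⟩ := h
        filter_upwards [eventually_mem_clubFilter (Sum.inl y : M ⊕ I)] with N hN _
          using ⟨y, hN, hy⟩
      · exact Eventually.of_forall fun _ h' => (h h').elim
    filter_upwards [ih hφ ρ, hw] with N h₁ h₂ S hS c
    constructor
    · rintro ⟨y, hy⟩
      have := (h₁ S hS _).1 hy
      rw [Fin.comp_snoc] at this
      exact ⟨y, this⟩
    · intro h
      obtain ⟨y, hyN, hy⟩ := h₂ _ (fun i => hS.subset (c i).2) h
      refine ⟨⟨y, hS.superset hyN⟩, (h₁ S hS _).2 ?_⟩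
      rwa [Fin.comp_snoc]
  | exRel | quant | conj => exact hφ.elim

/-- A formula of `L^{d⁻,ω}_𝒜` that is true in `M` is true in almost all substructures with a
suitable trace on `ω₁`. -/
theorem eventually_realize (hA : IsDenseChain A) {σ : List ℕ} {n : ℕ} (φ : PosFormula L σ n)
    (hφ : φ.IsMinus) (ρ : RelAssign M σ) (c : Fin n → M) (hc : φ.Realize A ρ c) :
    ∀ᶠ N in clubFilter (M ⊕ Set.Iio (ω₁ : Ordinal.{0})), IsContinuityTrace A N →
      ∀ S : L.Substructure M, (S : Set M) = Sum.inl ⁻¹' N →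
        ∀ a : Fin n → S, Subtype.val ∘ a = c →
          φ.Realize A (ρ.comap (Subtype.val : S → M)) a := by
  induction φ with
  | fo φ =>
    filter_upwards [eventually_realize_iff (A := A) (I := Set.Iio (ω₁ : Ordinal.{0}))
      (.fo φ) trivial ρ] with N hN _ S hS a ha
    exact (hN S hS a).2 (ha ▸ hc)
  | and φ ψ ihφ ihψ =>
    filter_upwards [ihφ hφ.1 ρ c hc.1, ihψ hφ.2 ρ c hc.2] with N h₁ h₂ hδ S hS a ha
    exact ⟨h₁ hδ S hS a ha, h₂ hδ S hS a ha⟩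
  | or φ ψ ihφ ihψ =>
    rcases hc with hc | hc
    · filter_upwards [ihφ hφ.1 ρ c hc] with N h₁ hδ S hS a ha using Or.inl (h₁ hδ S hS a ha)
    · filter_upwards [ihψ hφ.2 ρ c hc] with N h₁ hδ S hS a ha using Or.inr (h₁ hδ S hS a ha)
  | all φ ih =>
    -- Each instance at `x` has its own set of good `N`; the diagonal intersection suffices, as the
    -- quantifier in the substructure ranges only over elements of `N`.
    filter_upwards [eventually_forall_inl fun x => ih hφ ρ (Fin.snoc c x) (hc x)]
      with N hN hδ S hS a ha x
    refine hN x (hS.subset x.2) hδ S hS _ ?_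
    rw [Fin.comp_snoc, ha]
  | ex φ ih =>
    obtain ⟨x, hx⟩ := hc
    filter_upwards [ih hφ ρ (Fin.snoc c x) hx,
      eventually_mem_clubFilter (Sum.inl x : M ⊕ Set.Iio (ω₁ : Ordinal.{0}))]
      with N hN hxN hδ S hS a ha
    refine ⟨⟨x, hS.superset hxN⟩, hN hδ S hS _ ?_⟩
    rw [Fin.comp_snoc, ha]
  | exRel k φ ih =>
    obtain ⟨R, hR⟩ := hc
    filter_upwards [ih hφ (ρ.cons R) c hR] with N hN hδ S hS a ha
    refine ⟨{x | Subtype.val ∘ x ∈ R}, ?_⟩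
    rw [← RelAssign.comap_cons]
    exact hN hδ S hS a ha
  | conj φ ih =>
    filter_upwards [eventually_countable_forall.2 fun i => ih i (hφ i) ρ c (hc i)]
      with N hN hδ S hS a ha i
    exact hN i hδ S hS a ha
  | @quant σ n ψ₀ ψ₁ ψ₂ ψ₃ ψ₄ =>
    obtain ⟨h0, h1, h2, h3, h4⟩ := hφ
    -- The equivalences for the `ψᵢ` identify the structure they define on `S` with the restriction
    -- of `D`; one-sided preservation would not do.
    filter_upwards [QHolds.eventually_comap hA hc,
      eventually_realize_iff (A := A) (I := Set.Iio (ω₁ : Ordinal.{0})) ψ₀ h0 ρ,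
      eventually_realize_iff (A := A) (I := Set.Iio (ω₁ : Ordinal.{0})) ψ₁ h1 ρ,
      eventually_realize_iff (A := A) (I := Set.Iio (ω₁ : Ordinal.{0})) ψ₂ h2 ρ,
      eventually_realize_iff (A := A) (I := Set.Iio (ω₁ : Ordinal.{0})) ψ₃ h3 ρ,
      eventually_realize_iff (A := A) (I := Set.Iio (ω₁ : Ordinal.{0})) ψ₄ h4 ρ]
      with N hN h0 h1 h2 h3 h4 hδ S hS a ha
    have hQ := hN hδ S Subtype.val (Subtype.range_coe.trans hS)
    have hs₁ : ∀ x : S, (Subtype.val ∘ (Fin.snoc a x : Fin (n + 1) → S) : Fin (n + 1) → M) =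
        Fin.snoc c x.1 := fun x => by rw [Fin.comp_snoc, ha]
    have hs₂ : ∀ x y : S, (Subtype.val ∘ (Fin.snoc (Fin.snoc a x : Fin (n + 1) → S) y :
        Fin (n + 2) → S) : Fin (n + 2) → M) = Fin.snoc (Fin.snoc c x.1 : Fin (n + 1) → M) y.1 :=
      fun x y => by rw [Fin.comp_snoc, hs₁]
    simp only [Realize]
    convert hQ using 1
    simp only [TauD.comap, TauD.mk.injEq]
    refine ⟨?_, ?_, ?_, ?_, ?_⟩
    · funext x y
      rw [h0 S hS, hs₂]
    · funext x y
      rw [h1 S hS, hs₂]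
    · funext x y
      rw [h2 S hS, hs₂]
    · funext x
      rw [h3 S hS, hs₁]
    · funext x
      rw [h4 S hS, hs₁]

/-! ### Countability of the finitary formulas -/

/-- The depth of a formula, infinite conjunctions being disregarded. -/
def depth : ∀ {σ : List ℕ} {n : ℕ}, PosFormula L σ n → ℕ
  | _, _, fo _ => 0
  | _, _, and φ ψ => max φ.depth ψ.depth + 1
  | _, _, or φ ψ => max φ.depth ψ.depth + 1
  | _, _, all φ => φ.depth + 1
  | _, _, ex φ => φ.depth + 1
  | _, _, exRel _ φ => φ.depth + 1
  | _, _, quant ψ₀ ψ₁ ψ₂ ψ₃ ψ₄ =>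
      max (max (max ψ₀.depth ψ₁.depth) ψ₂.depth) (max ψ₃.depth ψ₄.depth) + 1
  | _, _, conj _ => 0

end PosFormula

theorem countable_relVar (σ : List ℕ) : Countable (Σ k, RelVar σ k) := by
  induction σ with
  | nil =>
    have : IsEmpty (Σ k, RelVar [] k) := ⟨fun ⟨_, r⟩ => nomatch r⟩
    infer_instance
  | cons k σ ih =>
    refine Function.Surjective.countable (α := Option (Σ k, RelVar σ k))
      (f := fun r => r.elim ⟨k, .here⟩ fun r => ⟨r.1, .there r.2⟩) ?_
    rintro ⟨j, _ | r⟩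
    · exact ⟨none, rfl⟩
    · exact ⟨some ⟨j, r⟩, rfl⟩

theorem countable_symbols_withRels {L : FirstOrder.Language.{u, v}} (hL : Countable L.Symbols)
    (σ : List ℕ) : Countable (withRels L σ).Symbols := by
  have := countable_relVar σ
  have hF : Countable (Σ l, L.Functions l) := Sum.inl_injective.countable (β := L.Symbols)
  have hR : Countable (Σ l, L.Relations l) := Sum.inr_injective.countable (β := L.Symbols)
  have h₁ : Countable (Σ l, (withRels L σ).Functions l) :=
    (Equiv.sigmaSumDistrib L.Functions fun _ => Empty).injective.countable
  have h₂ : Countable (Σ l, (withRels L σ).Relations l) :=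
    (Equiv.sigmaSumDistrib L.Relations (RelVar σ)).injective.countable
  exact inferInstanceAs (Countable (_ ⊕ _))

/-- Induction on a depth bound, uniformly in the context and the number of variables, because
quantifiers change both. The strict bound makes the base case empty. -/
theorem countable_isFinitary_depth_le {L : FirstOrder.Language.{u, v}} (hL : Countable L.Symbols)
    (d : ℕ) (σ : List ℕ) (n : ℕ) :
    {φ : PosFormula L σ n | φ.IsFinitary ∧ φ.depth < d}.Countable := by
  induction d generalizing σ n with
  | zero => simp
  | succ d ih =>
    have := countable_symbols_withRels hL σ
    let F : ∀ (σ : List ℕ) (n : ℕ), Set (PosFormula L σ n) :=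
      fun σ n => {φ | φ.IsFinitary ∧ φ.depth < d}
    have hF : ∀ σ n, (F σ n).Countable := ih
    have hc : (range (PosFormula.fo (L := L) (σ := σ) (n := n)) ∪
        image2 .and (F σ n) (F σ n) ∪ image2 .or (F σ n) (F σ n) ∪
        .all '' F σ (n + 1) ∪ .ex '' F σ (n + 1) ∪ (⋃ k, .exRel k '' F (k :: σ) n) ∪
        (fun p : (_ × _ × _) × _ × _ =>
          PosFormula.quant p.1.1 p.1.2.1 p.1.2.2 p.2.1 p.2.2) ''
          ((F σ (n + 2) ×ˢ F σ (n + 2) ×ˢ F σ (n + 2)) ×ˢ F σ (n + 1) ×ˢ F σ (n + 1))).Countable := by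
      refine .union (.union (.union (.union (.union (.union (countable_range _)
        ((hF _ _).image2 (hF _ _) _)) ((hF _ _).image2 (hF _ _) _)) ((hF _ _).image _))
        ((hF _ _).image _)) (countable_iUnion fun k => (hF _ _).image _)) (.image ?_ _)
      exact ((hF _ _).prod ((hF _ _).prod (hF _ _))).prod ((hF _ _).prod (hF _ _))
    refine hc.mono ?_
    rintro φ ⟨hφ, hd⟩
    cases φ with
    | fo φ => simp
    | and φ ψ =>
      simp only [PosFormula.depth, Nat.add_lt_add_iff_right, max_lt_iff] at hd
      refine .inl <| .inl <| .inl <| .inl <| .inl <| .inr ?_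
      exact ⟨φ, ⟨hφ.1, hd.1⟩, ψ, ⟨hφ.2, hd.2⟩, rfl⟩
    | or φ ψ =>
      simp only [PosFormula.depth, Nat.add_lt_add_iff_right, max_lt_iff] at hd
      refine .inl <| .inl <| .inl <| .inl <| .inr ?_
      exact ⟨φ, ⟨hφ.1, hd.1⟩, ψ, ⟨hφ.2, hd.2⟩, rfl⟩
    | all φ => exact .inl <| .inl <| .inl <| .inr ⟨φ, ⟨hφ, Nat.lt_of_succ_lt_succ hd⟩, rfl⟩
    | ex φ => exact .inl <| .inl <| .inr ⟨φ, ⟨hφ, Nat.lt_of_succ_lt_succ hd⟩, rfl⟩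
    | exRel k φ =>
      exact .inl <| .inr <| mem_iUnion.2 ⟨k, φ, ⟨hφ, Nat.lt_of_succ_lt_succ hd⟩, rfl⟩
    | quant ψ₀ ψ₁ ψ₂ ψ₃ ψ₄ =>
      simp only [PosFormula.depth, Nat.add_lt_add_iff_right, max_lt_iff] at hd
      obtain ⟨⟨⟨d0, d1⟩, d2⟩, d3, d4⟩ := hd
      obtain ⟨h0, h1, h2, h3, h4⟩ := hφ
      exact .inr ⟨((ψ₀, ψ₁, ψ₂), ψ₃, ψ₄),
        ⟨⟨⟨h0, d0⟩, ⟨h1, d1⟩, ⟨h2, d2⟩⟩, ⟨h3, d3⟩, ⟨h4, d4⟩⟩, rfl⟩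
    | conj φ => exact hφ.elim

theorem countable_LdMinus {L : FirstOrder.Language.{u, v}} (hL : Countable L.Symbols)
    (σ : List ℕ) (n : ℕ) : (LdMinus L σ n).Countable := by
  refine (countable_iUnion fun d => countable_isFinitary_depth_le hL d σ n).mono fun φ hφ => ?_
  exact mem_iUnion.2 ⟨φ.depth + 1, hφ.2, Nat.lt_succ_self _⟩

/-! ### The downward Löwenheim–Skolem theorem -/

theorem eventually_exists_substructure {L : FirstOrder.Language.{u, v}} (hL : Countable L.Symbols)
    {M : Type w} [L.Structure M] {I : Type*} :
    ∀ᶠ N in clubFilter (M ⊕ I), ∃ S : L.Substructure M, (S : Set M) = Sum.inl ⁻¹' N := by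
  have h : ∀ᶠ N in clubFilter (M ⊕ I), ∀ (F : Σ l, L.Functions l) (x : Fin F.1 → M),
      (∀ i, Sum.inl (x i) ∈ N) → Sum.inl (Language.Structure.funMap F.2 x) ∈ N :=
    eventually_countable_forall.2 fun F => eventually_forall_tuple fun x =>
      eventually_mem_clubFilter _
  filter_upwards [h] with N hN
  exact ⟨⟨Sum.inl ⁻¹' N, fun {l} F x hx => hN ⟨l, F⟩ x hx⟩, rfl⟩

/-- Common core of both assertions: countability of `Γ` lets the requirements of all its formulas be
met by the same `N`. The trace condition stays a premise inside the "almost all" statement and is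
discharged only once a suitable `N` has been obtained from stationarity. -/
theorem exists_negElementary {A : Set.Iio (ω₁ : Ordinal.{0}) → Set (ℕ → Bool)}
    (hA : IsDenseChain A) {L : FirstOrder.Language.{u, v}} (hL : Countable L.Symbols)
    {M : Type w} [L.Structure M] {X : Set M} (hX : X.Countable) {Γ : FormulaSet L}
    (hΓ : ∀ n, (Γ [] n).Countable) (hΓm : ∀ n, Γ [] n ⊆ LdMinusOmega L [] n) :
    ∃ N : L.Substructure M, X ⊆ N ∧ Countable N ∧ NegElementary A Γ N := by
  have h : ∀ᶠ N in clubFilter (M ⊕ Set.Iio (ω₁ : Ordinal.{0})), ∀ n, ∀ φ ∈ Γ [] n,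
      ∀ c : Fin n → M, (∀ i, Sum.inl (c i) ∈ N) → φ.Realize A RelAssign.nil c →
        IsContinuityTrace A N → ∀ S : L.Substructure M, (S : Set M) = Sum.inl ⁻¹' N →
          ∀ a : Fin n → S, Subtype.val ∘ a = c →
            φ.Realize A (RelAssign.nil.comap (Subtype.val : S → M)) a := by
    refine eventually_countable_forall.2 fun n => (eventually_countable_ball (hΓ n)).2 fun φ hφ =>
      eventually_forall_tuple fun c => ?_
    by_cases hc : φ.Realize A RelAssign.nil c
    · filter_upwards [φ.eventually_realize hA (hΓm n hφ) RelAssign.nil c hc] with N hN _ using hN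
    · exact Eventually.of_forall fun N h' => (hc h').elim
  obtain ⟨N, ⟨hN, S, hS⟩, hNc, hXN, hδ⟩ := exists_countable_of_isStationary hA.stationary
    (h.and (eventually_exists_substructure hL)) hX
  refine ⟨S, fun x hx => hS.superset (hXN x hx), ?_, fun n φ hφ a ha => ?_⟩
  · have : (S : Set M).Countable := hS ▸ hNc.preimage Sum.inl_injective
    exact this.to_subtype
  · have := hN n φ hφ _ (fun i => hS.subset (a i).2) ha hδ S hS a rfl
    rwa [RelAssign.comap_nil] at this

end DensityLogic

theorem mainTheorem6
    (A : Set.Iio (ω₁ : Ordinal.{0}) → Set (ℕ → Bool)) (hA : DensityLogic.IsDenseChain A)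
    {L : FirstOrder.Language.{u, v}} (hL : Countable L.Symbols)
    {M : Type w} [L.Structure M] (X : Set M) (hX : X.Countable) :
    (∃ N : L.Substructure M, X ⊆ N ∧ Countable N ∧
      DensityLogic.NegElementary A (DensityLogic.LdMinus L) N) ∧
    (∀ Γ : DensityLogic.FormulaSet L, DensityLogic.IsFragment Γ →
      (∀ σ n, (Γ σ n).Countable) → (∀ σ n, Γ σ n ⊆ DensityLogic.LdMinusOmega L σ n) →
      ∃ N : L.Substructure M, X ⊆ N ∧ Countable N ∧
        DensityLogic.NegElementary A Γ N) :=
  ⟨DensityLogic.exists_negElementary hA hL hX (fun n => DensityLogic.countable_LdMinus hL [] n)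
    fun _ _ hφ => hφ.1,
   fun _ _ hΓ hΓm => DensityLogic.exists_negElementary hA hL hX (hΓ []) (hΓm [])⟩
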